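/- Let $X$ be an infinite-dimensional real or complex Banach space. Its density character $d(X)$ is the smallest cardinality of a dense subset of $X$. Let $\mathfrak{b}$ denote the bounding cardinal, that is, the smallest cardinality of a set $F\subseteq\mathbb{N}^{\mathbb{N}}$ that is unbounded for eventual dominance, meaning that there is no $\beta\in\mathbb{N}^{\mathbb{N}}$ such that for every $\alpha\in F$ the set $\{n\in\mathbb{N}:\alpha(n)>\beta(n)\}$ is finite. If $\aleph_0\le d(X)<\mathfrak{b}$, then $X$ has a separable quotient, that is, there is a closed linear subspace $Y$ of $X$ such that $X/Y$ is separable and infinite-dimensional. -/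

import Mathlib

universe u

/-- Eventual dominance on `ℕ → ℕ`: `α n ≤ β n` for all but finitely many `n`. -/
def EventuallyDominatedBy (α β : ℕ → ℕ) : Prop :=
  {n : ℕ | β n < α n}.Finite

/-- A family of functions is bounded for eventual dominance if a single function
eventually dominates every member of it. -/
def IsDominanceBounded (F : Set (ℕ → ℕ)) : Prop :=
  ∃ β : ℕ → ℕ, ∀ α ∈ F, EventuallyDominatedBy α β

/-- The bounding cardinal `𝔟`: the least cardinality of a family in `ℕ → ℕ` that is
unbounded for eventual dominance. -/
noncomputable def boundingCardinal : Cardinal.{0} :=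
  sInf {κ : Cardinal.{0} | ∃ F : Set (ℕ → ℕ), ¬ IsDominanceBounded F ∧ Cardinal.mk F = κ}

/-- The density character of a topological space: the least cardinality of a dense subset. -/
noncomputable def densityCharacter (X : Type*) [TopologicalSpace X] : Cardinal :=
  sInf {κ : Cardinal | ∃ D : Set X, Dense D ∧ Cardinal.mk D = κ}

/-- `X` has a separable quotient: for some closed linear subspace `Y`, the quotient
`X ⧸ Y` is separable and infinite-dimensional. -/
def HasSeparableQuotient (𝕜 X : Type*) [RCLike 𝕜] [NormedAddCommGroup X]
    [NormedSpace 𝕜 X] : Prop :=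
  ∃ Y : Submodule 𝕜 X, IsClosed (Y : Set X) ∧
    TopologicalSpace.SeparableSpace (X ⧸ Y) ∧ ¬ FiniteDimensional 𝕜 (X ⧸ Y)

/-! If X is reflexive, divide by the common kernel Y of countably many independent functionals: by
reflexivity the functionals vanishing on Y form the closed span of that countable set, so X/Y has a
separable dual and is itself separable.

If X is not reflexive, a James sequence yields a weak-star null sequence f_n bounded away from zero
in norm (Josefson–Nissenzweig). Either convex tail combinations can be refined to a weak-star Cauchy
sequence, whose suitable differences work, or oscillation persists and half-differences build a
Bessel system.

The cardinal enters once. For x in a dense set of size less than 𝔟, record how fast f_n(x) tends to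
0; one function dominates all these rates. So f_n can be thinned out and multiplied by rapidly
growing scalars T while staying eventually bounded by 1 at each such x. The scaled g_n are almost
biorthogonal to short vectors z_n, and a convergent correction turns "eventually bounded" into
"eventually zero" on a dense set. The quotient by the common kernel of the g_n is then separable,
and Banach–Steinhaus makes it infinite-dimensional. -/

/-! ### Separable quotients from eventually vanishing functionals -/

open Filter Topology in
/-- A sequence of functionals, unbounded in norm, whose terms eventually vanish at every point of a
dense set, yields a separable quotient. -/
theorem hasSeparableQuotient_of_dense_eventually_zero {𝕜 X : Type*} [RCLike 𝕜]
    [NormedAddCommGroup X] [NormedSpace 𝕜 X] [CompleteSpace X] (g : ℕ → StrongDual 𝕜 X)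
    (hd : Dense {x | ∀ᶠ n in atTop, g n x = 0})
    (hunb : ¬ ∃ C, ∀ n, ‖g n‖ ≤ C) : HasSeparableQuotient 𝕜 X := by
  let E : ℕ → Submodule 𝕜 X := fun N =>
    { carrier := {x | ∀ n, N ≤ n → g n x = 0}
      add_mem' := fun {a b} ha hb n hn => by simp [ha n hn, hb n hn]
      zero_mem' := fun n _ => by simp
      smul_mem' := fun c x hx n hn => by simp [hx n hn] }
  have hE : ∀ N x, x ∈ E N ↔ ∀ n, N ≤ n → g n x = 0 := fun N x => Iff.rfl
  have hset : {x | ∀ᶠ n in atTop, g n x = 0} = ⋃ N, (E N : Set X) := by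
    ext x
    simp [eventually_atTop, hE]
  have hY : IsClosed (E 0 : Set X) := by
    have : (E 0 : Set X) = ⋂ n, {x | g n x = 0} := by
      ext x
      simp [hE]
    rw [this]
    exact isClosed_iInter fun n => isClosed_eq (g n).continuous continuous_const
  have := hY
  -- Modulo `E 0`, a vector of `E N` is determined by the values of its first `N` functionals.
  have hfin : ∀ N, FiniteDimensional 𝕜 ((E N).map (E 0).mkQ) := by
    intro N
    let Φ : E N →ₗ[𝕜] (Fin N → 𝕜) :=
      (LinearMap.pi fun i : Fin N => (g i : X →ₗ[𝕜] 𝕜)) ∘ₗ (E N).subtype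
    let Ψ : E N →ₗ[𝕜] X ⧸ E 0 := (E 0).mkQ ∘ₗ (E N).subtype
    have hker : LinearMap.ker Φ ≤ LinearMap.ker Ψ := by
      intro x hx
      have hx' : ∀ i : Fin N, g i (x : X) = 0 := fun i => congrFun hx i
      change (E 0).mkQ (x : X) = 0
      rw [Submodule.mkQ_apply, Submodule.Quotient.mk_eq_zero]
      intro n _
      by_cases hn : n < N
      · exact hx' ⟨n, hn⟩
      · exact x.2 n (not_lt.1 hn)
    have hq : FiniteDimensional 𝕜 (E N ⧸ LinearMap.ker Φ) :=
      Module.Finite.equiv Φ.quotKerEquivRange.symm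
    have hr : LinearMap.range Ψ = LinearMap.range ((LinearMap.ker Φ).liftQ Ψ hker) :=
      (Submodule.range_liftQ _ _ hker).symm
    have hm : (E N).map (E 0).mkQ = LinearMap.range Ψ := by
      rw [LinearMap.range_comp, Submodule.range_subtype]
    rw [hm, hr]
    infer_instance
  have hdq : Dense (⋃ N, ((E N).map (E 0).mkQ : Set (X ⧸ E 0))) := by
    have h := (Submodule.mkQ_surjective (E 0)).denseRange.dense_image
      (continuous_quotient_mk' : Continuous (E 0).mkQ) hd
    rw [hset, Set.image_iUnion] at h
    exact h
  refine ⟨E 0, hY, ?_, ?_⟩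
  · have hsep : TopologicalSpace.IsSeparable (⋃ N, ((E N).map (E 0).mkQ : Set (X ⧸ E 0))) := by
      refine TopologicalSpace.IsSeparable.iUnion fun N => ?_
      have : ProperSpace ((E N).map (E 0).mkQ) := FiniteDimensional.proper 𝕜 _
      exact TopologicalSpace.IsSeparable.of_subtype _
    rw [← TopologicalSpace.isSeparable_univ_iff, ← hdq.closure_eq]
    exact hsep.closure
  · intro hfd
    apply hunb
    have hmono : Monotone E := fun a b hab x hx n hn => hx n (hab.trans hn)
    have hmono' : Monotone fun N => (E N).map (E 0).mkQ := fun a b hab =>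
      Submodule.map_mono (hmono hab)
    -- In a finite-dimensional quotient the dense increasing union is a closed subspace, hence
    -- everything; so X is the union of the `E N` and the `g n` are pointwise bounded.
    have hS : (⋃ N, ((E N).map (E 0).mkQ : Set (X ⧸ E 0))) = Set.univ := by
      rw [← Submodule.coe_iSup_of_directed _ hmono'.directed_le] at hdq ⊢
      rw [← (Submodule.closed_of_finiteDimensional _).closure_eq, hdq.closure_eq]
    refine banach_steinhaus fun x => ?_
    obtain ⟨N, y, hy, hyx⟩ := Set.mem_iUnion.1 (hS ▸ Set.mem_univ ((E 0).mkQ x))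
    have hx : x ∈ E N := by
      have h0 : x - y ∈ E N := hmono (Nat.zero_le N) ((Submodule.Quotient.eq _).1 hyx.symm)
      simpa using (E N).add_mem h0 hy
    refine ⟨∑ i ∈ Finset.range N, ‖g i x‖, fun n => ?_⟩
    by_cases hn : n < N
    · exact Finset.single_le_sum (f := fun i => ‖g i x‖) (fun i _ => norm_nonneg _)
        (Finset.mem_range.2 hn)
    · rw [hx n (not_lt.1 hn), norm_zero]
      exact Finset.sum_nonneg fun i _ => norm_nonneg _

/-! ### Correction of almost biorthogonal systems -/

/-- One correction step: an almost diagonal system of functionals can be halved on the tail. -/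
theorem exists_half_correction {𝕜 X : Type*} [RCLike 𝕜] [NormedAddCommGroup X] [NormedSpace 𝕜 X]
    [CompleteSpace X] {g : ℕ → StrongDual 𝕜 X} {z : ℕ → X} {L : ℝ}
    (hz : ∀ j, ‖z j‖ ≤ L * (1 / 2) ^ j) (hdiag : ∀ n, g n (z n) = 1)
    (hoff : ∀ n j, j ≠ n → ‖g n (z j)‖ ≤ (1 / 2) ^ j / 4) {N : ℕ} {s : ℝ} (hs : 0 ≤ s) {x : X}
    (hx : ∀ n, N ≤ n → ‖g n x‖ ≤ s) :
    ∃ y, ‖y‖ ≤ s * (2 * L * (1 / 2) ^ N) ∧ ∀ n, N ≤ n → ‖g n (x - y)‖ ≤ s / 2 := by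
  have hL : 0 ≤ L := by simpa using (norm_nonneg _).trans (hz 0)
  -- The correction is y = ∑_{j ≥ N} g_j(x) z_j: its diagonal term cancels g_n(x), and the
  -- off-diagonal terms add up to at most ∑ (s/4) 2^{-j} = s/2.
  let c : ℕ → 𝕜 := fun j => if N ≤ j then g j x else 0
  have hc : ∀ j, ‖c j‖ ≤ s := fun j => by
    by_cases h : N ≤ j
    · simpa [c, h] using hx j h
    · simpa [c, h] using hs
  have hgeo : HasSum (fun j : ℕ => s * L * (1 / 2 : ℝ) ^ (N + j)) (s * (2 * L * (1 / 2) ^ N)) := by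
    have h := hasSum_geometric_two.mul_left (s * L * (1 / 2) ^ N)
    rw [show s * (2 * L * (1 / 2) ^ N) = s * L * (1 / 2) ^ N * 2 by ring]
    simpa only [pow_add, mul_assoc] using h
  let t : ℕ → X := fun j => c (N + j) • z (N + j)
  have ht : ∀ j, ‖t j‖ ≤ s * L * (1 / 2 : ℝ) ^ (N + j) := fun j => by
    rw [norm_smul, mul_assoc]
    exact mul_le_mul (hc _) (hz _) (norm_nonneg _) hs
  have hsum : Summable t := .of_norm_bounded hgeo.summable ht
  refine ⟨∑' j, t j, tsum_of_norm_bounded hgeo ht, fun n hn => ?_⟩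
  obtain ⟨k, rfl⟩ := Nat.exists_eq_add_of_le hn
  have h1 : HasSum (fun j => g (N + k) (t j)) (g (N + k) (∑' j, t j)) :=
    hsum.hasSum.mapL (g (N + k))
  have h2 := h1.sub (hasSum_ite_eq k (g (N + k) x))
  rw [map_sub, norm_sub_rev]
  have hb : HasSum (fun j : ℕ => s / 4 * (1 / 2 : ℝ) ^ j) (s / 2) := by
    rw [show s / 2 = s / 4 * 2 by ring]
    exact hasSum_geometric_two.mul_left (s / 4)
  rw [← h2.tsum_eq]
  refine tsum_of_norm_bounded hb fun j => ?_
  by_cases hj : j = k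
  · subst hj
    simp [t, c, hdiag]
    positivity
  · simp only [hj, if_false, sub_zero, t, map_smul, norm_smul]
    have h3 := hoff (N + k) (N + j) (by omega)
    have h4 : (1 / 2 : ℝ) ^ (N + j) ≤ (1 / 2) ^ j :=
      pow_le_pow_of_le_one (by norm_num) (by norm_num) (by omega)
    calc ‖c (N + j)‖ * ‖g (N + k) (z (N + j))‖ ≤ s * ((1 / 2) ^ j / 4) :=
          mul_le_mul (hc _) (h3.trans (by linarith)) (norm_nonneg _) hs
      _ = s / 4 * (1 / 2) ^ j := by ring

open Filter Topology in
/-- For an almost diagonal system `g n (z j)` with `z` rapidly decreasing, the vectors at which the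
functionals `g n` eventually vanish are dense as soon as those at which they are eventually bounded
by one are. -/
theorem dense_eventually_zero {𝕜 X : Type*} [RCLike 𝕜] [NormedAddCommGroup X] [NormedSpace 𝕜 X]
    [CompleteSpace X] {g : ℕ → StrongDual 𝕜 X} {z : ℕ → X} {L : ℝ}
    (hz : ∀ j, ‖z j‖ ≤ L * (1 / 2) ^ j) (hdiag : ∀ n, g n (z n) = 1)
    (hoff : ∀ n j, j ≠ n → ‖g n (z j)‖ ≤ (1 / 2) ^ j / 4)
    {D : Set X} (hD : Dense D) (hb : ∀ x ∈ D, ∀ᶠ n in atTop, ‖g n x‖ ≤ 1) :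
    Dense {x | ∀ᶠ n in atTop, g n x = 0} := by
  have hL : 0 ≤ L := by simpa using (norm_nonneg _).trans (hz 0)
  suffices h : D ⊆ closure {x | ∀ᶠ n in atTop, g n x = 0} from
    fun x => closure_minimal h isClosed_closure (hD x)
  intro x hx
  obtain ⟨N₀, hN₀⟩ := eventually_atTop.1 (hb x hx)
  have key : ∀ N, N₀ ≤ N →
      ∃ y ∈ {x | ∀ᶠ n in atTop, g n x = 0}, dist x y ≤ 4 * L * (1 / 2) ^ N := by
    intro N hN
    -- Iterating the halving from bound 1 moves x by at most 2L 2^{-N} 2^{-i} at step i, hence by 4L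
    -- 2^{-N} in total; the limit is killed by all `g n` with `n ≥ N`.
    let S : ℕ → Set X := fun i => {y | ∀ n, N ≤ n → ‖g n y‖ ≤ (1 / 2) ^ i}
    have step : ∀ i (y : S i), ∃ y' : S (i + 1),
        dist (y : X) y' ≤ 4 * L * (1 / 2) ^ N / 2 / 2 ^ i := by
      rintro i ⟨y, hy⟩
      obtain ⟨w, hw, hw'⟩ := exists_half_correction hz hdiag hoff (by positivity) hy
      refine ⟨⟨y - w, fun n hn => (hw' n hn).trans_eq (by ring)⟩, ?_⟩
      rw [dist_eq_norm]
      simp only [sub_sub_cancel]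
      refine hw.trans_eq ?_
      rw [one_div_pow _ i]
      ring
    choose F hF using step
    let y : ∀ i, S i := fun i => Nat.rec (motive := fun i => S i)
      ⟨x, fun n hn => by simpa using hN₀ n (hN.trans hn)⟩ (fun i y => F i y) i
    have hd : ∀ i, dist (y i).1 (y (i + 1)).1 ≤ 4 * L * (1 / 2) ^ N / 2 / 2 ^ i :=
      fun i => hF i (y i)
    obtain ⟨a, ha⟩ := cauchySeq_tendsto_of_complete (cauchySeq_of_le_geometric_two hd)
    refine ⟨a, eventually_atTop.2 ⟨N, fun n hn => ?_⟩,
      dist_le_of_le_geometric_two_of_tendsto₀ hd ha⟩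
    have h1 : Tendsto (fun i => ‖g n (y i).1‖) atTop (𝓝 ‖g n a‖) :=
      (((g n).continuous.tendsto a).comp ha).norm
    have h2 : Tendsto (fun i : ℕ => (1 / 2 : ℝ) ^ i) atTop (𝓝 0) :=
      tendsto_pow_atTop_nhds_zero_of_lt_one (by norm_num) (by norm_num)
    exact norm_le_zero_iff.1 (le_of_tendsto_of_tendsto' h1 h2 fun i => (y i).2 n hn)
  refine Metric.mem_closure_iff.2 fun ε hε => ?_
  have h0 : Tendsto (fun N : ℕ => 4 * L * (1 / 2 : ℝ) ^ N) atTop (𝓝 0) := by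
    simpa using (tendsto_pow_atTop_nhds_zero_of_lt_one (r := (1 / 2 : ℝ)) (by norm_num)
      (by norm_num)).const_mul (4 * L)
  obtain ⟨N, hN, hN'⟩ := ((h0.eventually (gt_mem_nhds hε)).and (eventually_ge_atTop N₀)).exists
  obtain ⟨y, hy, hxy⟩ := key N hN'
  exact ⟨y, hy, hxy.trans_lt hN⟩

/-! ### The bounding cardinal and the choice of scaled functionals -/

/-- Every family of fewer than `𝔟` functions is bounded for eventual dominance. -/
theorem isDominanceBounded_range {ι : Type u} (h : Cardinal.mk ι < Cardinal.lift.{u} boundingCardinal)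
    (α : ι → ℕ → ℕ) : IsDominanceBounded (Set.range α) := by
  by_contra hF
  have h1 : boundingCardinal ≤ Cardinal.mk (Set.range α) := csInf_le' ⟨_, hF, rfl⟩
  have h2 : Cardinal.lift.{u} (Cardinal.mk (Set.range α)) ≤ Cardinal.lift.{0} (Cardinal.mk ι) :=
    Cardinal.mk_range_le_lift
  rw [Cardinal.lift_uzero] at h2
  exact absurd h ((Cardinal.lift_le.2 h1).trans h2).not_gt

/-- A dense subset whose cardinality is the density character. -/
theorem exists_dense_mk_eq_densityCharacter (X : Type u) [TopologicalSpace X] :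
    ∃ D : Set X, Dense D ∧ Cardinal.mk D = densityCharacter X :=
  csInf_mem (s := {κ : Cardinal | ∃ D : Set X, Dense D ∧ Cardinal.mk D = κ})
    ⟨_, Set.univ, dense_univ, rfl⟩

/-- Existence of rapidly increasing scaling factors. -/
theorem exists_rapid_scaling (C : ℝ) : ∃ T : ℕ → ℝ, (∀ j, 1 ≤ T j) ∧ (∀ j, 2 ^ j ≤ T j) ∧
    ∀ n j, n < j → C * 2 ^ j * T n ≤ T j := by
  let Q := max 1 C
  have hQ : 1 ≤ Q := le_max_left _ _
  have hR : 1 ≤ 2 * Q := by linarith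
  have h1 : ∀ j : ℕ, (2 : ℝ) ^ j ≤ (2 * Q) ^ j := fun j =>
    pow_le_pow_left₀ (by norm_num) (by linarith) _
  -- Square exponents suffice because j + n² ≤ j² whenever n < j.
  refine ⟨fun j => (2 * Q) ^ (j * j), fun j => one_le_pow₀ hR, fun j =>
    (h1 j).trans (pow_le_pow_right₀ hR (Nat.le_mul_self j)), fun n j hnj => ?_⟩
  have h2 : C * 2 ^ j ≤ (2 * Q) ^ j := by
    rw [mul_pow, mul_comm]
    gcongr
    exact (le_max_right _ _).trans (le_self_pow₀ hQ (by omega))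
  calc C * 2 ^ j * (2 * Q) ^ (n * n) ≤ (2 * Q) ^ j * (2 * Q) ^ (n * n) := by gcongr
    _ = (2 * Q) ^ (j + n * n) := (pow_add _ _ _).symm
    _ ≤ (2 * Q) ^ (j * j) := pow_le_pow_right₀ hR (by nlinarith)

open Filter Topology in
/-- In a Banach space of density character less than `𝔟`, a weak-star null sequence of functionals
bounded away from zero in norm yields a separable quotient. -/
theorem hasSeparableQuotient_of_weakStar_null {𝕜 : Type*} [RCLike 𝕜] {X : Type u}
    [NormedAddCommGroup X] [NormedSpace 𝕜 X] [CompleteSpace X]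
    (hup : densityCharacter X < Cardinal.lift.{u} boundingCardinal)
    {f : ℕ → StrongDual 𝕜 X} {c : ℝ} (hc : 0 < c) (hf : ∀ n, c ≤ ‖f n‖)
    (h0 : ∀ x, Tendsto (fun n => f n x) atTop (𝓝 0)) : HasSeparableQuotient 𝕜 X := by
  obtain ⟨D, hD, hcard⟩ := exists_dense_mk_eq_densityCharacter X
  obtain ⟨K, hK⟩ : ∃ K, ∀ n, ‖f n‖ ≤ K := by
    refine banach_steinhaus fun x => ?_
    obtain ⟨C, hC⟩ := (h0 x).norm.bddAbove_range
    exact ⟨C, fun n => hC ⟨n, rfl⟩⟩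
  have hK0 : 0 ≤ K := (norm_nonneg _).trans (hK 0)
  have hw : ∀ n, ∃ w, f n w = 1 ∧ ‖w‖ ≤ 2 / c := by
    intro n
    obtain ⟨v, hv, hv'⟩ := (f n).exists_lt_apply_of_lt_opNorm (r := c / 2) (by linarith [hf n])
    have hne : f n v ≠ 0 := norm_pos_iff.1 (lt_trans (by positivity) hv')
    refine ⟨(f n v)⁻¹ • v, by simp [hne], ?_⟩
    rw [norm_smul, norm_inv, ← one_div, div_mul_eq_mul_div, one_mul,
      div_le_div_iff₀ (norm_pos_iff.2 hne) hc]
    nlinarith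
  choose w hw1 hw2 using hw
  obtain ⟨T, hT1, hT2, hT⟩ := exists_rapid_scaling (4 * (K * (2 / c)))
  have hTpos : ∀ k, 0 < T k := fun k => one_pos.trans_le (hT1 k)
  have hsmall : ∀ x (ε : ℝ), 0 < ε → ∃ N, ∀ n, N ≤ n → ‖f n x‖ ≤ ε := fun x ε hε =>
    eventually_atTop.1 (((tendsto_zero_iff_norm_tendsto_zero.1 (h0 x)).eventually
      (gt_mem_nhds hε)).mono fun n h => h.le)
  -- `α x k` is an index from which |f_n(x)| ≤ 1 / T_k, so any n_k ≥ `α x k` keeps T_k f_{n_k}(x)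
  -- bounded by 1.
  choose α hα using fun x : X => fun k : ℕ => hsmall x (1 / T k) (by simp [hTpos])
  obtain ⟨β, hβ⟩ := isDominanceBounded_range (hcard ▸ hup) (fun x : D => α x)
  -- A pair is (level k, index n) with n ≥ β(k). Weak-star nullity allows n to be so large that f_n
  -- is tiny at all earlier vectors `w`.
  obtain ⟨p, hp, hpp⟩ := exists_seq_of_forall_finset_exists (α := ℕ × ℕ)
    (fun p => β p.1 ≤ p.2)
    (fun p q => p.1 < q.1 ∧ ‖f q.2 (w p.2)‖ ≤ 1 / (4 * 2 ^ p.1 * T q.1)) (by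
      intro s _
      obtain ⟨k, hk⟩ : ∃ k, ∀ p ∈ s, p.1 < k :=
        ⟨s.sup Prod.fst + 1, fun p hp => Nat.lt_succ_of_le (Finset.le_sup (f := Prod.fst) hp)⟩
      have hev : ∀ᶠ n in atTop, β k ≤ n ∧ ∀ p ∈ s, ‖f n (w p.2)‖ ≤ 1 / (4 * 2 ^ p.1 * T k) := by
        refine (eventually_ge_atTop _).and ((Filter.eventually_all_finset s).2 fun p _ => ?_)
        have := hTpos k
        exact eventually_atTop.2 (hsmall (w p.2) _ (by positivity))
      obtain ⟨n, hn, hn'⟩ := hev.exists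
      exact ⟨(k, n), hn, fun p hp => ⟨hk p hp, hn' p hp⟩⟩)
  have hmono : StrictMono fun i => (p i).1 := fun i j hij => (hpp i j hij).1
  have hid : ∀ i, i ≤ (p i).1 := fun i => hmono.le_apply
  have hhalf : ∀ j, (1 / 2 : ℝ) ^ (p j).1 ≤ (1 / 2) ^ j := fun j =>
    pow_le_pow_of_le_one (by norm_num) (by norm_num) (hid j)
  let g : ℕ → StrongDual 𝕜 X := fun i => (T (p i).1 : 𝕜) • f (p i).2
  let z : ℕ → X := fun i => ((T (p i).1 : 𝕜)⁻¹) • w (p i).2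
  have hnT : ∀ k, ‖(T k : 𝕜)‖ = T k := fun k => by
    rw [RCLike.norm_ofReal, abs_of_pos (hTpos k)]
  have hne : ∀ k, (T k : 𝕜) ≠ 0 := fun k => by exact_mod_cast (hTpos k).ne'
  have hgz : ∀ n j, ‖g n (z j)‖ = T (p n).1 / T (p j).1 * ‖f (p n).2 (w (p j).2)‖ := by
    intro n j
    simp only [g, z, smul_apply, map_smul, norm_smul, norm_inv, hnT]
    ring
  have hz : ∀ j, ‖z j‖ ≤ 2 / c * (1 / 2) ^ j := by
    intro j
    simp only [z, norm_smul, norm_inv, hnT]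
    have h1 : (T (p j).1)⁻¹ ≤ (1 / 2) ^ (p j).1 := by
      rw [one_div, inv_pow]
      exact inv_anti₀ (by positivity) (hT2 _)
    rw [mul_comm]
    exact mul_le_mul (hw2 _) (h1.trans (hhalf j)) (inv_nonneg.2 (hTpos _).le) (by positivity)
  have hoff : ∀ n j, j ≠ n → ‖g n (z j)‖ ≤ (1 / 2) ^ j / 4 := by
    intro n j hjn
    refine le_trans ?_ (div_le_div_of_nonneg_right (hhalf j) (by norm_num))
    rw [hgz, div_mul_eq_mul_div, div_le_iff₀ (hTpos _)]
    have hTn := hTpos (p n).1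
    -- For j < n the choice of the index makes the entry small; for n < j the growth of `T` does.
    rcases lt_or_gt_of_ne hjn with h | h
    · have h1 := (hpp j n h).2
      calc T (p n).1 * ‖f (p n).2 (w (p j).2)‖
          ≤ T (p n).1 * (1 / (4 * 2 ^ (p j).1 * T (p n).1)) := by gcongr
        _ = (1 / 2) ^ (p j).1 / 4 * 1 := by
          rw [one_div_pow]; field_simp
        _ ≤ _ := by gcongr; exact hT1 _
    · have h1 := hT _ _ (hmono h)
      have h2 : ‖f (p n).2 (w (p j).2)‖ ≤ K * (2 / c) :=
        ((f (p n).2).le_opNorm _).trans (mul_le_mul (hK _) (hw2 _) (norm_nonneg _) hK0)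
      calc T (p n).1 * ‖f (p n).2 (w (p j).2)‖ ≤ T (p n).1 * (K * (2 / c)) := by gcongr
        _ = (1 / 2) ^ (p j).1 / 4 * (4 * (K * (2 / c)) * 2 ^ (p j).1 * T (p n).1) := by
          rw [one_div_pow]; field_simp
        _ ≤ _ := by gcongr
  have hdiag : ∀ n, g n (z n) = 1 := fun n => by
    simp [g, z, hw1, hne]
  refine hasSeparableQuotient_of_dense_eventually_zero g
    (dense_eventually_zero hz hdiag hoff hD fun x hx => ?_) ?_
  · have hfin : {n | β n < α x n}.Finite := hβ _ ⟨⟨x, hx⟩, rfl⟩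
    have hev : ∀ᶠ n in atTop, α x n ≤ β n := by
      rw [← Nat.cofinite_eq_atTop]
      filter_upwards [hfin.compl_mem_cofinite] with n hn using not_lt.1 hn
    filter_upwards [hmono.tendsto_atTop.eventually hev] with i hi
    have h1 := hα x (p i).1 (p i).2 (hi.trans (hp i))
    simp only [g, smul_apply, norm_smul, hnT]
    rwa [le_div_iff₀' (hTpos _)] at h1
  · rintro ⟨C, hC⟩
    obtain ⟨i, hi⟩ := pow_unbounded_of_one_lt (C / c) (one_lt_two (α := ℝ))
    have h1 : (2 : ℝ) ^ i * c ≤ ‖g i‖ := by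
      simp only [g, norm_smul, hnT]
      exact mul_le_mul ((pow_le_pow_right₀ one_le_two (hid i)).trans (hT2 _)) (hf _) hc.le
        (hTpos _).le
    rw [div_lt_iff₀ hc] at hi
    linarith [hC i]

/-! ### James' criterion for nonreflexive spaces -/

/-- Off the range of a nonsurjective linear isometry of a Banach space there is a unit vector at
distance at least one half from the range. -/
theorem LinearIsometry.exists_far_from_range {X V : Type*} [NormedAddCommGroup X]
    [NormedSpace ℝ X] [CompleteSpace X] [NormedAddCommGroup V] [NormedSpace ℝ V] (J : X →ₗᵢ[ℝ] V)
    (hJ : ¬ Function.Surjective J) : ∃ F : V, ‖F‖ = 1 ∧ ∀ x, 1 / 2 ≤ ‖F - J x‖ := by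
  have hcl : IsClosed (LinearMap.range J.toLinearMap : Set V) :=
    J.isometry.isClosedEmbedding.isClosed_range
  obtain ⟨F, -, hF1, hF⟩ := riesz_lemma_of_lt_one hcl
    (by simpa [Function.Surjective] using hJ) (r := 1 / 2) (by norm_num)
  exact ⟨F, hF1, fun x => hF _ ⟨x, rfl⟩⟩

/-- A functional that is small on the common kernel of finitely many functionals is close to their
span. -/
theorem exists_mem_span_norm_sub_le {V ι : Type*} [NormedAddCommGroup V] [NormedSpace ℝ V]
    [Finite ι] (L : ι → StrongDual ℝ V) (F : StrongDual ℝ V) {c : ℝ} (hc : 0 ≤ c)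
    (h : ∀ f, (∀ i, L i f = 0) → ‖f‖ ≤ 1 → F f ≤ c) :
    ∃ G ∈ Submodule.span ℝ (Set.range L), ‖F - G‖ ≤ c := by
  let W : Submodule ℝ V := ⨅ i, LinearMap.ker (L i : V →ₗ[ℝ] ℝ)
  have hW : ∀ f, f ∈ W ↔ ∀ i, L i f = 0 := fun f => by
    simp only [W, Submodule.mem_iInf, LinearMap.mem_ker]
    rfl
  have hnorm : ‖F.comp W.subtypeL‖ ≤ c := by
    refine ContinuousLinearMap.opNorm_le_of_unit_norm hc fun f hf => ?_
    have hf' : ‖(f : V)‖ = 1 := hf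
    refine abs_le.2 ⟨?_, h f ((hW f).1 f.2) hf'.le⟩
    have h := h (-f) ((hW _).1 (W.neg_mem f.2)) (by rw [norm_neg, hf'])
    rw [map_neg] at h
    change -c ≤ F f
    linarith
  -- If G extends F|_W with the same norm, F - G vanishes on the common kernel W and so lies in the
  -- span.
  obtain ⟨G, hG, hG'⟩ := exists_extension_norm_eq W (F.comp W.subtypeL)
  have hspan : ((F - G : StrongDual ℝ V) : V →ₗ[ℝ] ℝ) ∈
      Submodule.span ℝ (Set.range fun i => (L i : V →ₗ[ℝ] ℝ)) := by
    refine mem_span_of_iInf_ker_le_ker fun f hf => ?_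
    have h := hG ⟨f, hf⟩
    change F f - G f = 0
    rw [sub_eq_zero]
    exact h.symm
  refine ⟨F - G, ?_, by rw [sub_sub_cancel, hG']; exact hnorm⟩
  have hrange : (Set.range fun i => (L i : V →ₗ[ℝ] ℝ)) =
      (ContinuousLinearMap.coeLM ℝ : StrongDual ℝ V →ₗ[ℝ] V →ₗ[ℝ] ℝ) '' Set.range L := by
    rw [← Set.range_comp]
    rfl
  rw [hrange, Submodule.span_image] at hspan
  obtain ⟨H, hH, hHe⟩ := hspan
  rwa [← ContinuousLinearMap.coe_injective hHe]

/-- A bidual functional far from the canonical image stays large on the annihilator of any finite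
set. -/
theorem exists_annihilating_functional {X : Type*} [NormedAddCommGroup X] [NormedSpace ℝ X]
    {F : StrongDual ℝ (StrongDual ℝ X)}
    (hF : ∀ x, 1 / 2 ≤ ‖F - NormedSpace.inclusionInDoubleDual ℝ X x‖) (s : Finset X) :
    ∃ f : StrongDual ℝ X, ‖f‖ ≤ 1 ∧ 1 / 4 ≤ F f ∧ ∀ x ∈ s, f x = 0 := by
  by_contra! hcon
  -- Otherwise F would be within 1/4 of the canonical image, whereas its distance is at least 1/2.
  obtain ⟨G, hG, hFG⟩ := exists_mem_span_norm_sub_le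
    (fun x : s => NormedSpace.inclusionInDoubleDual ℝ X x) F (c := 1 / 4) (by norm_num)
    fun f hf hf1 => by
      by_contra! h
      obtain ⟨x, hx, hx'⟩ := hcon f hf1 h.le
      exact hx' (hf ⟨x, hx⟩)
  have hle : Submodule.span ℝ (Set.range fun x : s => NormedSpace.inclusionInDoubleDual ℝ X x) ≤
      LinearMap.range (NormedSpace.inclusionInDoubleDual ℝ X : X →ₗ[ℝ] _) :=
    Submodule.span_le.2 (by rintro _ ⟨x, rfl⟩; exact ⟨x, rfl⟩)
  obtain ⟨x, rfl⟩ := hle hG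
  have h := hF x
  change ‖F - NormedSpace.inclusionInDoubleDual ℝ X x‖ ≤ _ at hFG
  linarith

/-- A quantitative form of Helly's lemma: a bidual functional of norm at most one that is large on
finitely many functionals is imitated by a vector of the unit ball. -/
theorem exists_vector_large_on_finset {X : Type*} [NormedAddCommGroup X] [NormedSpace ℝ X]
    {F : StrongDual ℝ (StrongDual ℝ X)} (hF : ‖F‖ ≤ 1) (s : Finset (StrongDual ℝ X))
    (hs : ∀ f ∈ s, 1 / 4 ≤ F f) : ∃ x : X, ‖x‖ ≤ 1 ∧ ∀ f ∈ s, 1 / 8 < f x := by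
  classical
  by_contra! hcon
  let T : X →L[ℝ] (s → ℝ) := ContinuousLinearMap.pi fun f : s => (f : StrongDual ℝ X)
  have hopen : IsOpen (Set.univ.pi fun _ : s => Set.Ioi (1 / 8 : ℝ)) :=
    isOpen_set_pi Set.finite_univ fun _ _ => isOpen_Ioi
  have hdisj : Disjoint (Set.univ.pi fun _ : s => Set.Ioi (1 / 8 : ℝ))
      (T '' Metric.closedBall 0 1) := by
    rw [Set.disjoint_left]
    rintro _ h ⟨x, hx, rfl⟩
    obtain ⟨f, hf, hfx⟩ := hcon x (by simpa using hx)
    exact (h ⟨f, hf⟩ trivial).not_ge hfx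
  -- The separating functional gives φ = ∑ a_f f with F(φ) < r and ‖φ‖ ≤ -r, contradicting ‖F‖ ≤ 1.
  obtain ⟨ℓ, r, h1, h2⟩ := geometric_hahn_banach_open
    (convex_pi fun _ _ => convex_Ioi _) hopen
    ((convex_closedBall (0 : X) 1).linear_image (T : X →ₗ[ℝ] s → ℝ)) hdisj
  let a : s → ℝ := fun f => ℓ (Pi.single f 1)
  have hℓ : ∀ v : s → ℝ, ℓ v = ∑ f, v f * a f := fun v => by
    conv_lhs => rw [← LinearMap.sum_single_apply (φ := fun _ => ℝ) v]
    simp only [a, map_sum]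
    refine Finset.sum_congr rfl fun f _ => ?_
    rw [← smul_eq_mul, ← map_smul, ← Pi.single_smul, smul_eq_mul, mul_one]
  let φ : StrongDual ℝ X := ∑ f, a f • (f : StrongDual ℝ X)
  have hφ : ∀ x, φ x = ℓ (T x) := fun x => by
    rw [hℓ]
    simp [φ, T, mul_comm]
  have hFφ : F φ < r := by
    have h := h1 (fun f => F f) fun f _ => lt_of_lt_of_le (by norm_num) (hs f f.2)
    rw [hℓ] at h
    simpa [φ, mul_comm] using h
  have hr : r ≤ 0 := by
    simpa using h2 0 ⟨0, by simp, by simp⟩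
  have hnorm : ‖φ‖ ≤ -r := by
    refine ContinuousLinearMap.opNorm_le_of_unit_norm (by linarith) fun x hx => abs_le.2 ⟨?_, ?_⟩
    · have := h2 _ ⟨x, by simp [hx], rfl⟩
      rw [hφ, neg_neg]
      exact this
    · have := h2 _ ⟨-x, by simp [hx], rfl⟩
      have e : ℓ (T (-x)) = -φ x := by rw [← hφ, map_neg]
      change r ≤ ℓ (T (-x)) at this
      linarith
  have hFn : |F φ| ≤ ‖φ‖ := by
    simpa using F.le_of_opNorm_le hF φ
  linarith [neg_abs_le (F φ)]

/-- James' criterion: a nonreflexive Banach space carries a triangular system of functionals and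
vectors in the unit balls. -/
theorem exists_james_sequence {X : Type*} [NormedAddCommGroup X] [NormedSpace ℝ X]
    [CompleteSpace X]
    (hJ : ¬ Function.Surjective (NormedSpace.inclusionInDoubleDual ℝ X)) :
    ∃ (f : ℕ → StrongDual ℝ X) (x : ℕ → X), (∀ n, ‖f n‖ ≤ 1) ∧ (∀ n, ‖x n‖ ≤ 1) ∧
      (∀ i n, i ≤ n → 1 / 8 < f i (x n)) ∧ ∀ k n, k < n → f n (x k) = 0 := by
  classical
  obtain ⟨F, hF1, hF⟩ := LinearIsometry.exists_far_from_range
    (V := StrongDual ℝ (StrongDual ℝ X)) (NormedSpace.inclusionInDoubleDualLi (E := X) ℝ) hJ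
  -- Keeping F(f) ≥ 1/4 for every chosen f is what lets the next vector be large on all of them at
  -- once.
  obtain ⟨p, hp, hpp⟩ := exists_seq_of_forall_finset_exists (α := StrongDual ℝ X × X)
    (fun p => ‖p.1‖ ≤ 1 ∧ 1 / 4 ≤ F p.1 ∧ 1 / 8 < p.1 p.2 ∧ ‖p.2‖ ≤ 1)
    (fun p q => q.1 p.2 = 0 ∧ 1 / 8 < p.1 q.2) (by
      intro s hs
      obtain ⟨f, hf1, hf2, hf3⟩ := exists_annihilating_functional hF (s.image Prod.snd)
      obtain ⟨x, hx1, hx⟩ := exists_vector_large_on_finset hF1.le (insert f (s.image Prod.fst)) (by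
        intro φ hφ
        rcases Finset.mem_insert.1 hφ with rfl | hφ
        · exact hf2
        · obtain ⟨q, hq, rfl⟩ := Finset.mem_image.1 hφ
          exact (hs q hq).2.1)
      exact ⟨(f, x), ⟨hf1, hf2, hx f (Finset.mem_insert_self _ _), hx1⟩, fun q hq =>
        ⟨hf3 _ (Finset.mem_image_of_mem _ hq),
          hx _ (Finset.mem_insert_of_mem (Finset.mem_image_of_mem _ hq))⟩⟩)
  refine ⟨fun n => (p n).1, fun n => (p n).2, fun n => (hp n).1,
    fun n => (hp n).2.2.2, fun i n hin => ?_,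
    fun k n hkn => (hpp k n hkn).1⟩
  rcases hin.eq_or_lt with rfl | h
  · exact (hp i).2.2.1
  · exact (hpp i n h).2

/-! ### Tail-convex sequences and the Josefson–Nissenzweig dichotomy -/

/-- The terms of `b` are convex combinations of the later and later terms of `h`. -/
def IsTailConvex {E : Type*} [AddCommGroup E] [Module ℝ E] (b h : ℕ → E) : Prop :=
  ∀ m, b m ∈ convexHull ℝ (h '' Set.Ici m)

/-- The pointwise oscillation of the sequence `b` on the unit ball is at most `δ`. -/
def OscillationLE {X : Type*} [NormedAddCommGroup X] [NormedSpace ℝ X] (b : ℕ → StrongDual ℝ X)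
    (δ : ℝ) : Prop :=
  ∀ x, ‖x‖ ≤ 1 → ∃ N, ∀ n, N ≤ n → ∀ m, N ≤ m → b n x - b m x ≤ δ

theorem IsTailConvex.refl {E : Type*} [AddCommGroup E] [Module ℝ E] (h : ℕ → E) :
    IsTailConvex h h :=
  fun m => subset_convexHull ℝ _ ⟨m, Set.mem_Ici.2 le_rfl, rfl⟩

theorem IsTailConvex.convexHull_subset {E : Type*} [AddCommGroup E] [Module ℝ E] {b h : ℕ → E}
    (hb : IsTailConvex b h) (m : ℕ) :
    convexHull ℝ (b '' Set.Ici m) ⊆ convexHull ℝ (h '' Set.Ici m) := by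
  refine convexHull_min ?_ (convex_convexHull ℝ _)
  rintro _ ⟨n, hn, rfl⟩
  exact convexHull_mono (Set.image_mono (Set.Ici_subset_Ici.2 hn)) (hb n)

theorem IsTailConvex.trans {E : Type*} [AddCommGroup E] [Module ℝ E] {a b h : ℕ → E}
    (hab : IsTailConvex a b) (hbh : IsTailConvex b h) : IsTailConvex a h :=
  fun m => hbh.convexHull_subset m (hab m)

-- Differences of convex combinations are convex combinations of differences, and being at most δ at
-- x is a half-space condition. The index `i` discards initial terms, as a diagonal sequence
-- requires.
open scoped Pointwise in
theorem OscillationLE.of_eventually_mem {X : Type*} [NormedAddCommGroup X] [NormedSpace ℝ X]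
    {b d : ℕ → StrongDual ℝ X} {δ : ℝ} (hb : OscillationLE b δ) {i : ℕ}
    (hd : ∀ j, i ≤ j → d j ∈ convexHull ℝ (b '' Set.Ici j)) : OscillationLE d δ := by
  intro x hx
  obtain ⟨N, hN⟩ := hb x hx
  have hmem : ∀ j, max N i ≤ j → d j ∈ convexHull ℝ (b '' Set.Ici N) := fun j hj =>
    convexHull_mono (Set.image_mono (Set.Ici_subset_Ici.2 ((le_max_left _ _).trans hj)))
      (hd j ((le_max_right _ _).trans hj))
  refine ⟨max N i, fun n hn m hm => ?_⟩
  have h1 : d n - d m ∈ convexHull ℝ (b '' Set.Ici N - b '' Set.Ici N) := by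
    rw [convexHull_sub]
    exact Set.sub_mem_sub (hmem n hn) (hmem m hm)
  have h2 : convexHull ℝ (b '' Set.Ici N - b '' Set.Ici N) ⊆
      {φ : StrongDual ℝ X | φ x ≤ δ} := by
    refine convexHull_min ?_ (convex_halfSpace_le (f := fun φ : StrongDual ℝ X => φ x)
      ⟨fun _ _ => rfl, fun _ _ => rfl⟩ δ)
    rintro _ ⟨_, ⟨p, hp, rfl⟩, _, ⟨q, hq, rfl⟩, rfl⟩
    exact hN p hp q hq
  exact h2 h1

/-- If every tail-convex sequence of `h` oscillates, there are vectors of the unit ball on which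
finite Rademacher-like systems of functionals of any length are bounded below. -/
theorem exists_rademacher_systems {X : Type*} [NormedAddCommGroup X] [NormedSpace ℝ X]
    {h : ℕ → StrongDual ℝ X} (hh : ∀ n, ‖h n‖ ≤ 1) {δ : ℝ}
    (hosc : ∀ b, IsTailConvex b h → ¬ OscillationLE b δ) :
    ∃ x : ℕ → X, (∀ n, ‖x n‖ ≤ 1) ∧ ∀ k, ∃ u : ℕ → StrongDual ℝ X,
      (∀ y, ∑ j ∈ Finset.range k, u j y ^ 2 ≤ ‖y‖ ^ 2) ∧ ∀ j < k, δ / 2 ≤ u j (x j) := by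
  let I : ℕ → (ℕ → X) × (ℕ → StrongDual ℝ X) × (ℕ → ℕ → StrongDual ℝ X) → Prop := fun k σ =>
    (∀ j < k, ‖σ.1 j‖ ≤ 1) ∧ IsTailConvex σ.2.1 h ∧
    (∀ m y, σ.2.1 m y ^ 2 + ∑ j ∈ Finset.range k, σ.2.2 m j y ^ 2 ≤ ‖y‖ ^ 2) ∧
    ∀ m, ∀ j < k, δ / 2 ≤ σ.2.2 m j (σ.1 j)
  have step : ∀ k (σ : {σ // I k σ}), ∃ τ : {τ // I (k + 1) τ}, ∀ j < k, τ.1.1 j = σ.1.1 j := by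
    rintro k ⟨⟨x, a, u⟩, hx, ha, hau, hu⟩
    have hna := hosc a ha
    simp only [OscillationLE] at hna
    push Not at hna
    obtain ⟨y, hy, hy'⟩ := hna
    choose n hn m hm hnm using hy'
    have hne : ∀ j < k, j ≠ k := fun j hj => hj.ne
    -- Half-sums replace `a` and half-differences become the new `u k`. The parallelogram identity
    -- for `a` and convexity of the square for the old `u j` preserve the Bessel bound; oscillation
    -- above δ at y gives the lower bound δ/2.
    refine ⟨⟨⟨Function.update x k y, fun N => (1 / 2 : ℝ) • (a (n N) + a (m N)), fun N j =>
      if j = k then (1 / 2 : ℝ) • (a (n N) - a (m N)) else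
        (1 / 2 : ℝ) • (u (n N) j + u (m N) j)⟩, ?_, ?_, ?_, ?_⟩, ?_⟩
    · intro j hj
      by_cases hjk : j = k
      · subst hjk; simpa using hy
      · simpa [hjk] using hx j (by omega)
    · intro N
      have h1 := convexHull_mono (Set.image_mono (Set.Ici_subset_Ici.2 (hn N))) (ha (n N))
      have h2 := convexHull_mono (Set.image_mono (Set.Ici_subset_Ici.2 (hm N))) (ha (m N))
      have := (convex_convexHull ℝ (h '' Set.Ici N)) h1 h2 (a := 1 / 2) (b := 1 / 2)
        (by norm_num) (by norm_num) (by norm_num)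
      simpa only [smul_add] using this
    · intro N w
      have h1 := hau (n N) w
      have h2 := hau (m N) w
      have h3 : ∑ j ∈ Finset.range k, ((1 / 2 : ℝ) * (u (n N) j w + u (m N) j w)) ^ 2 ≤
          (∑ j ∈ Finset.range k, u (n N) j w ^ 2 + ∑ j ∈ Finset.range k, u (m N) j w ^ 2) / 2 := by
        rw [← Finset.sum_add_distrib, Finset.sum_div]
        refine Finset.sum_le_sum fun j _ => ?_
        nlinarith [sq_nonneg (u (n N) j w - u (m N) j w)]
      have h4 : ∑ j ∈ Finset.range k, ((if j = k then (1 / 2 : ℝ) • (a (n N) - a (m N)) else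
          (1 / 2 : ℝ) • (u (n N) j + u (m N) j)) w) ^ 2 =
          ∑ j ∈ Finset.range k, ((1 / 2 : ℝ) * (u (n N) j w + u (m N) j w)) ^ 2 := by
        refine Finset.sum_congr rfl fun j hj => ?_
        rw [if_neg (hne j (Finset.mem_range.1 hj))]
        rfl
      simp only [Finset.sum_range_succ]
      rw [h4, if_pos trivial]
      change ((1 / 2 : ℝ) * (a (n N) w + a (m N) w)) ^ 2 +
        (_ + ((1 / 2 : ℝ) * (a (n N) w - a (m N) w)) ^ 2) ≤ _
      nlinarith
    · intro N j hj
      by_cases hjk : j = k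
      · subst hjk
        simp only [if_true, Function.update_self]
        change _ ≤ (1 / 2 : ℝ) * (a (n N) y - a (m N) y)
        linarith [hnm N]
      · simp only [hjk, if_false, Function.update_of_ne hjk]
        change _ ≤ (1 / 2 : ℝ) * (u (n N) j (x j) + u (m N) j (x j))
        have h1 := hu (n N) j (by omega)
        have h2 := hu (m N) j (by omega)
        simp only at h1 h2
        linarith
    · intro j hj
      exact Function.update_of_ne (hne j hj) _ _
  choose S hS using step
  have h0 : I 0 (fun _ => 0, h, fun _ _ => 0) := by
    refine ⟨by simp, .refl h, fun m y => ?_, by simp⟩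
    have h1 : |h m y| ≤ ‖y‖ := by simpa using (h m).le_of_opNorm_le (hh m) y
    simpa using sq_le_sq' (by linarith [neg_abs_le (h m y)]) ((le_abs_self _).trans h1)
  let st : ∀ k, {σ // I k σ} := fun k => Nat.rec (motive := fun k => {σ // I k σ})
    ⟨_, h0⟩ (fun k σ => S k σ) k
  have hstep : ∀ k j, j < k → (st (k + 1)).1.1 j = (st k).1.1 j := fun k j hj => hS k (st k) j hj
  have hconst : ∀ j k, j + 1 ≤ k → (st k).1.1 j = (st (j + 1)).1.1 j := fun j k hk => by
    induction k, hk using Nat.le_induction with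
    | base => rfl
    | succ k hk ih => rw [hstep k j hk, ih]
  refine ⟨fun j => (st (j + 1)).1.1 j, fun j => (st (j + 1)).2.1 j (Nat.lt_succ_self j),
    fun k => ⟨(st k).1.2.2 0, fun y => ?_, fun j hj => ?_⟩⟩
  · have := (st k).2.2.2.1 0 y
    nlinarith [sq_nonneg ((st k).1.2.1 0 y)]
  · change δ / 2 ≤ (st k).1.2.2 0 j ((st (j + 1)).1.1 j)
    rw [← hconst j k hj]
    exact (st k).2.2.2.2 0 j hj

open Filter Topology in
/-- Weak-star limits of finite square-summable systems of functionals of increasing length. -/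
theorem exists_bessel_sequence {X : Type*} [NormedAddCommGroup X] [NormedSpace ℝ X]
    {x : ℕ → X} {ε : ℝ}
    (hx : ∀ k, ∃ u : ℕ → StrongDual ℝ X,
      (∀ y, ∑ j ∈ Finset.range k, u j y ^ 2 ≤ ‖y‖ ^ 2) ∧ ∀ j < k, ε ≤ u j (x j)) :
    ∃ v : ℕ → StrongDual ℝ X, (∀ k y, ∑ j ∈ Finset.range k, v j y ^ 2 ≤ ‖y‖ ^ 2) ∧
      ∀ j, ε ≤ v j (x j) := by
  choose u hu hux using hx
  have hnorm : ∀ k, ∀ j < k, ‖u k j‖ ≤ 1 := fun k j hj => by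
    refine ContinuousLinearMap.opNorm_le_bound _ zero_le_one fun y => ?_
    rw [one_mul]
    refine abs_le_of_sq_le_sq ?_ (norm_nonneg y)
    exact (Finset.single_le_sum (f := fun j => u k j y ^ 2) (fun i _ => sq_nonneg _)
      (Finset.mem_range.2 hj)).trans (hu k y)
  let U : ℕ → ℕ → WeakDual ℝ X := fun k j => if j < k then StrongDual.toWeakDual (u k j) else 0
  have hUeq : ∀ k j, j < k → ∀ y, U k j y = u k j y := fun k j hj y => by
    simp [U, hj]
  let B : Set (WeakDual ℝ X) :=
    WeakDual.toStrongDual ⁻¹' Metric.closedBall (0 : StrongDual ℝ X) 1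
  have hK : IsCompact (Set.univ.pi fun _ : ℕ => B) :=
    isCompact_univ_pi fun _ => WeakDual.isCompact_closedBall _ _
  have hUK : ∀ k, U k ∈ Set.univ.pi fun _ : ℕ => B := fun k j _ => by
    by_cases hj : j < k
    · simpa [B, U, hj] using hnorm k j hj
    · simp [B, U, hj]
  -- An ultrafilter limit replaces a subsequence, since the weak-star ball need not be sequentially
  -- compact.
  obtain ⟨v, -, hv⟩ := hK.ultrafilter_le_nhds ((hyperfilter ℕ).map U)
    (le_principal_iff.2 (mem_map.2 (Filter.univ_mem' hUK)))
  have hlim : ∀ j y, Tendsto (fun k => u k j y) (hyperfilter ℕ) (𝓝 (v j y)) := fun j y => by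
    have h1 : Tendsto U (hyperfilter ℕ) (𝓝 v) := hv
    have h2 : Tendsto (fun k => U k j y) (hyperfilter ℕ) (𝓝 (v j y)) :=
      ((WeakDual.eval_continuous y).tendsto (v j)).comp
        (((continuous_apply j).tendsto v).comp h1)
    refine h2.congr' ?_
    filter_upwards [Nat.hyperfilter_le_atTop (eventually_gt_atTop j)] with k hk
      using hUeq k j hk y
  refine ⟨fun j => WeakDual.toStrongDual (v j), fun k y => ?_, fun j => ?_⟩
  · refine le_of_tendsto (tendsto_finsetSum _ fun j _ => (hlim j y).pow 2) ?_
    filter_upwards [Nat.hyperfilter_le_atTop (eventually_ge_atTop k)] with K hK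
    exact (Finset.sum_le_sum_of_subset_of_nonneg (Finset.range_mono hK)
      fun _ _ _ => sq_nonneg _).trans (hu K y)
  · refine ge_of_tendsto (hlim j (x j)) ?_
    filter_upwards [Nat.hyperfilter_le_atTop (eventually_gt_atTop j)] with k hk
      using hux k j hk

open Filter Topology in
/-- A square-summable Rademacher-like system is weak-star null and bounded away from zero. -/
theorem exists_weakStar_null_of_oscillation {X : Type*} [NormedAddCommGroup X] [NormedSpace ℝ X]
    {h : ℕ → StrongDual ℝ X} (hh : ∀ n, ‖h n‖ ≤ 1) {δ : ℝ} (hδ : 0 < δ)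
    (hosc : ∀ b, IsTailConvex b h → ¬ OscillationLE b δ) :
    ∃ (u : ℕ → StrongDual ℝ X) (c : ℝ), 0 < c ∧ (∀ n, c ≤ ‖u n‖) ∧
      ∀ y, Tendsto (fun n => u n y) atTop (𝓝 0) := by
  obtain ⟨x, hx, hsys⟩ := exists_rademacher_systems hh hosc
  obtain ⟨v, hv, hvx⟩ := exists_bessel_sequence hsys
  refine ⟨v, δ / 2, by positivity, fun n => ?_, fun y => ?_⟩
  · calc δ / 2 ≤ v n (x n) := hvx n
      _ ≤ ‖v n (x n)‖ := le_abs_self _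
      _ ≤ ‖v n‖ * ‖x n‖ := (v n).le_opNorm _
      _ ≤ ‖v n‖ := mul_le_of_le_one_right (norm_nonneg _) (hx n)
  · have hs : Summable fun n => v n y ^ 2 :=
      summable_of_sum_range_le (fun n => sq_nonneg _) fun k => hv k y
    have h1 : Tendsto (fun n => √(v n y ^ 2)) atTop (𝓝 √0) :=
      (Real.continuous_sqrt.tendsto 0).comp hs.tendsto_atTop_zero
    simp only [Real.sqrt_sq_eq_abs, Real.sqrt_zero] at h1
    exact (tendsto_zero_iff_abs_tendsto_zero _).2 h1

/-- If tail-convex sequences can always be refined to small oscillation, then some tail-convex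
sequence is weak-star Cauchy. -/
theorem exists_isTailConvex_cauchy {X : Type*} [NormedAddCommGroup X] [NormedSpace ℝ X]
    {f : ℕ → StrongDual ℝ X}
    (hf : ∀ h, IsTailConvex h f → ∀ δ > 0, ∃ b, IsTailConvex b h ∧ OscillationLE b δ) :
    ∃ d, IsTailConvex d f ∧ ∀ δ > 0, OscillationLE d δ := by
  choose! R hR using hf
  have hδ : ∀ i : ℕ, (0 : ℝ) < 1 / (i + 1) := fun i => Nat.one_div_pos_of_nat
  let B : ℕ → ℕ → StrongDual ℝ X := fun i => Nat.rec (motive := fun _ => ℕ → StrongDual ℝ X) f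
    (fun i b => R b (1 / (i + 1))) i
  have hB : ∀ i, IsTailConvex (B i) f := fun i => by
    induction i with
    | zero => exact .refl f
    | succ i ih => exact (hR _ ih _ (hδ i)).1.trans ih
  have hBB : ∀ i j, i ≤ j → IsTailConvex (B j) (B i) := fun i j hij => by
    induction j, hij using Nat.le_induction with
    | base => exact .refl _
    | succ j hij ih => exact (hR _ (hB j) _ (hδ j)).1.trans ih
  have hosc : ∀ i : ℕ, OscillationLE (B (i + 1)) (1 / (i + 1)) := fun i =>
    (hR _ (hB i) _ (hδ i)).2
  -- Beyond index i + 1 the diagonal consists of tail-convex combinations of `B (i + 1)`, so it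
  -- inherits oscillation at most 1/(i + 1).
  refine ⟨fun i => B i i, fun m => hB m m, fun δ hδ' => ?_⟩
  obtain ⟨i, hi⟩ := exists_nat_one_div_lt hδ'
  have h := (hosc i).of_eventually_mem (d := fun i => B i i) (i := i + 1)
    fun j hj => hBB _ _ hj j
  intro x hx
  obtain ⟨N, hN⟩ := h x hx
  exact ⟨N, fun n hn m hm => (hN n hn m hm).trans hi.le⟩

open Filter Topology in
/-- The Josefson–Nissenzweig theorem for nonreflexive real Banach spaces. -/
theorem exists_weakStar_null_of_not_reflexive {X : Type*} [NormedAddCommGroup X] [NormedSpace ℝ X]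
    [CompleteSpace X] (hJ : ¬ Function.Surjective (NormedSpace.inclusionInDoubleDual ℝ X)) :
    ∃ (u : ℕ → StrongDual ℝ X) (c : ℝ), 0 < c ∧ (∀ n, c ≤ ‖u n‖) ∧
      ∀ y, Tendsto (fun n => u n y) atTop (𝓝 0) := by
  obtain ⟨f, x, hf, hx, hfx, hfx0⟩ := exists_james_sequence hJ
  by_cases hcase : ∃ h, IsTailConvex h f ∧ ∃ δ > 0, ∀ b, IsTailConvex b h → ¬ OscillationLE b δ
  · obtain ⟨h, hhf, δ, hδ, hosc⟩ := hcase
    refine exists_weakStar_null_of_oscillation (fun n => ?_) hδ hosc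
    have hsub : convexHull ℝ (f '' Set.Ici n) ⊆ Metric.closedBall 0 1 := by
      refine convexHull_min ?_ (convex_closedBall _ _)
      rintro _ ⟨m, -, rfl⟩
      simpa using hf m
    simpa using hsub (hhf n)
  push Not at hcase
  obtain ⟨d, hd, hosc⟩ := exists_isTailConvex_cauchy hcase
  have hlow : ∀ n, ∃ N, ∀ k, N ≤ k → 1 / 8 ≤ d n (x k) := fun n => by
    have hsub : convexHull ℝ (f '' Set.Ici n) ⊆
        {φ : StrongDual ℝ X | ∃ N, ∀ k, N ≤ k → 1 / 8 ≤ φ (x k)} := by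
      refine convexHull_min ?_ ?_
      · rintro _ ⟨m, -, rfl⟩
        exact ⟨m, fun k hk => (hfx m k hk).le⟩
      · rintro φ ⟨N, hN⟩ ψ ⟨M, hM⟩ a b ha hb hab
        refine ⟨max N M, fun k hk => ?_⟩
        have h1 := hN k ((le_max_left _ _).trans hk)
        have h2 := hM k ((le_max_right _ _).trans hk)
        change 1 / 8 ≤ a * φ (x k) + b * ψ (x k)
        nlinarith
    exact hsub (hd n)
  have hzero : ∀ n k, k < n → d n (x k) = 0 := fun n k hkn => by
    have hsub : convexHull ℝ (f '' Set.Ici n) ⊆ {φ : StrongDual ℝ X | φ (x k) = 0} := by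
      refine convexHull_min ?_ (convex_hyperplane (f := fun φ : StrongDual ℝ X => φ (x k))
        ⟨fun _ _ => rfl, fun _ _ => rfl⟩ 0)
      rintro _ ⟨m, hm, rfl⟩
      exact hfx0 k m (hkn.trans_le hm)
    exact hsub (hd n)
  choose K hK using hlow
  -- `M n` is one past max(n, K n): at that vector `d n` is at least 1/8 while `d (M n)` already
  -- vanishes. Since `M n ≥ n`, the Cauchy property makes the differences weak-star null.
  let M : ℕ → ℕ := fun n => max n (K n) + 1
  refine ⟨fun n => d n - d (M n), 1 / 8, by norm_num, fun n => ?_, ?_⟩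
  · have h1 := hK n (max n (K n)) (le_max_right _ _)
    have h2 := hzero (M n) (max n (K n)) (Nat.lt_succ_self _)
    calc (1 : ℝ) / 8 ≤ (d n - d (M n)) (x (max n (K n))) := by
          change _ ≤ d n _ - d (M n) _
          rw [h2]
          linarith
      _ ≤ ‖(d n - d (M n)) (x (max n (K n)))‖ := le_abs_self _
      _ ≤ ‖d n - d (M n)‖ * ‖x (max n (K n))‖ := ContinuousLinearMap.le_opNorm _ _
      _ ≤ ‖d n - d (M n)‖ := mul_le_of_le_one_right (norm_nonneg _) (hx _)
  · have hball : ∀ y : X, ‖y‖ ≤ 1 → Tendsto (fun n => (d n - d (M n)) y) atTop (𝓝 0) := by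
      intro y hy
      refine Metric.tendsto_atTop.2 fun ε hε => ?_
      obtain ⟨N, hN⟩ := hosc (ε / 2) (by positivity) y hy
      refine ⟨N, fun n hn => ?_⟩
      have hM : N ≤ M n := hn.trans ((le_max_left _ _).trans (Nat.le_succ _))
      rw [Real.dist_eq, sub_zero]
      change |d n y - d (M n) y| < ε
      have h1 := hN n hn _ hM
      have h2 := hN _ hM n hn
      exact (abs_le.2 ⟨by linarith, h1⟩).trans_lt (by linarith)
    intro y
    rcases eq_or_ne y 0 with rfl | hy
    · simp
    have h := (hball (‖y‖⁻¹ • y) (by simp [norm_smul, hy])).const_mul ‖y‖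
    simpa [← mul_assoc, hy] using h

/-! ### The reflexive case -/

/-- Hahn–Banach: a closed subspace is separated from any point outside by a functional. -/
theorem Submodule.exists_strongDual_ne_zero_of_notMem {𝕜 V : Type*} [RCLike 𝕜]
    [NormedAddCommGroup V] [NormedSpace 𝕜 V] {S : Submodule 𝕜 V} (hS : IsClosed (S : Set V))
    {v : V} (hv : v ∉ S) : ∃ F : StrongDual 𝕜 V, F v ≠ 0 ∧ ∀ w ∈ S, F w = 0 := by
  have := hS
  obtain ⟨G, hG⟩ := SeparatingDual.exists_ne_zero (R := 𝕜) (x := S.mkQ v) (by simpa using hv)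
  refine ⟨G.comp ⟨S.mkQ, continuous_quotient_mk'⟩, hG, fun w hw => ?_⟩
  have h : S.mkQ w = 0 := by simpa using hw
  change G (S.mkQ w) = 0
  rw [h, map_zero]

/-- A Banach space over `𝕜` which is reflexive as a real space is reflexive over `𝕜`. -/
theorem surjective_inclusionInDoubleDual_of_real {𝕜 X : Type*} [RCLike 𝕜] [NormedAddCommGroup X]
    [NormedSpace 𝕜 X] [NormedSpace ℝ X] [IsScalarTower ℝ 𝕜 X]
    (hJ : Function.Surjective (NormedSpace.inclusionInDoubleDual ℝ X)) :
    Function.Surjective (NormedSpace.inclusionInDoubleDual 𝕜 X) := by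
  intro F
  let e : StrongDual ℝ X ≃ₗᵢ[ℝ] StrongDual 𝕜 X := StrongDual.extendRCLikeₗᵢ
  let Φ : StrongDual ℝ (StrongDual ℝ X) :=
    RCLike.reCLM.comp ((F.restrictScalars ℝ).comp (e : StrongDual ℝ X →L[ℝ] StrongDual 𝕜 X))
  obtain ⟨x, hx⟩ := hJ Φ
  have hre : ∀ f : StrongDual 𝕜 X, RCLike.re (f x) = RCLike.re (F f) := fun f => by
    obtain ⟨g, rfl⟩ := e.surjective f
    have h1 : RCLike.re (e g x) = g x := StrongDual.re_extendRCLike_apply g x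
    rw [h1]
    exact congrArg (fun G : StrongDual ℝ (StrongDual ℝ X) => G g) hx
  refine ⟨x, ContinuousLinearMap.ext fun f => RCLike.ext (hre f) ?_⟩
  -- Real parts at i·f recover the imaginary parts at f.
  have h := hre ((RCLike.I : 𝕜) • f)
  rw [map_smul] at h
  change RCLike.re (RCLike.I * f x) = RCLike.re (RCLike.I * F f) at h
  rw [RCLike.I_mul_re, RCLike.I_mul_re, neg_inj] at h
  exact h

/-- The dual of an infinite-dimensional normed space contains an infinite countable linearly
independent set. -/
theorem exists_countable_linearIndepOn_strongDual {𝕜 X : Type*} [RCLike 𝕜] [NormedAddCommGroup X]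
    [NormedSpace 𝕜 X] (hinf : ¬ FiniteDimensional 𝕜 X) :
    ∃ s : Set (StrongDual 𝕜 X), s.Countable ∧ s.Infinite ∧ LinearIndepOn 𝕜 id s := by
  have hdual : ¬ FiniteDimensional 𝕜 (StrongDual 𝕜 X) := by
    intro h
    apply hinf
    let L : X →ₗ[𝕜] Module.Dual 𝕜 (StrongDual 𝕜 X) :=
      ContinuousLinearMap.coeLM 𝕜 ∘ₗ (NormedSpace.inclusionInDoubleDual 𝕜 X : X →ₗ[𝕜] _)
    refine FiniteDimensional.of_injective L
      ((injective_iff_map_eq_zero L).2 fun x hx => ?_)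
    by_contra hne
    obtain ⟨f, hf⟩ := SeparatingDual.exists_ne_zero (R := 𝕜) hne
    exact hf (LinearMap.congr_fun hx f)
  have hrank : Cardinal.aleph0 ≤ Module.rank 𝕜 (StrongDual 𝕜 X) := by
    rw [← not_lt, Module.rank_lt_aleph0_iff]
    exact hdual
  obtain ⟨s, hs, hli⟩ := le_rank_iff_exists_linearIndependent.1 hrank
  refine ⟨s, Set.countable_coe_iff.1 (Cardinal.mk_le_aleph0_iff.1 hs.le), ?_, hli⟩
  exact Set.infinite_coe_iff.1 (Cardinal.aleph0_le_mk_iff.1 hs.ge)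

/-- An infinite-dimensional reflexive Banach space has a separable quotient. -/
theorem hasSeparableQuotient_of_reflexive {𝕜 X : Type*} [RCLike 𝕜] [NormedAddCommGroup X]
    [NormedSpace 𝕜 X] (hinf : ¬ FiniteDimensional 𝕜 X)
    (hJ : Function.Surjective (NormedSpace.inclusionInDoubleDual 𝕜 X)) :
    HasSeparableQuotient 𝕜 X := by
  obtain ⟨s, hsc, hsi, hli⟩ := exists_countable_linearIndepOn_strongDual hinf
  let Y : Submodule 𝕜 X := ⨅ f ∈ s, LinearMap.ker (f : X →ₗ[𝕜] 𝕜)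
  have hY : ∀ x, x ∈ Y ↔ ∀ f ∈ s, f x = 0 := fun x => by
    simp [Y, Submodule.mem_iInf]
  have hYc : IsClosed (Y : Set X) := by
    have : (Y : Set X) = ⋂ f ∈ s, {x | f x = 0} := by
      ext x
      simp [hY]
    rw [this]
    exact isClosed_biInter fun f _ => isClosed_eq f.continuous continuous_const
  refine ⟨Y, hYc, ?_, ?_⟩
  · let Z : Submodule 𝕜 (StrongDual 𝕜 X) := (Submodule.span 𝕜 s).topologicalClosure
    -- A functional separating g from `Z` is, by reflexivity, evaluation at some x; vanishing on `s`
    -- puts x in `Y`, where g is zero.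
    have hZ : ∀ g : StrongDual 𝕜 X, (∀ y ∈ Y, g y = 0) → g ∈ Z := by
      intro g hg
      by_contra hgZ
      obtain ⟨F, hFg, hF⟩ := Submodule.exists_strongDual_ne_zero_of_notMem
        (Submodule.isClosed_topologicalClosure _) hgZ
      obtain ⟨x, rfl⟩ := hJ F
      exact hFg (hg x ((hY x).2 fun f hf =>
        hF f (Submodule.le_topologicalClosure _ (Submodule.subset_span hf))))
    have hZsep : TopologicalSpace.IsSeparable (Z : Set (StrongDual 𝕜 X)) := by
      rw [Submodule.topologicalClosure_coe]
      exact (hsc.isSeparable.span (R := 𝕜)).closure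
    obtain ⟨c, hc, hZc⟩ := hZsep
    have hy : ∀ h : StrongDual 𝕜 X, ∃ y : X, ‖y‖ ≤ 1 ∧ ‖h‖ / 2 ≤ ‖h y‖ := fun h => by
      rcases eq_or_ne h 0 with rfl | hne
      · exact ⟨0, by simp⟩
      · obtain ⟨y, hy, hy'⟩ := h.exists_lt_apply_of_lt_opNorm
          (half_lt_self (norm_pos_iff.2 hne))
        exact ⟨y, hy.le, hy'.le⟩
    choose y hy1 hy2 using hy
    let T : Submodule 𝕜 X := Y ⊔ Submodule.span 𝕜 (y '' c)
    have hT : Dense (T : Set X) := by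
      rw [Submodule.dense_iff_topologicalClosure_eq_top, eq_top_iff]
      intro v _
      by_contra hv
      obtain ⟨g, hgv, hg⟩ := Submodule.exists_strongDual_ne_zero_of_notMem
        (Submodule.isClosed_topologicalClosure _) hv
      have hgT : ∀ w ∈ T, g w = 0 := fun w hw => hg w (Submodule.le_topologicalClosure _ hw)
      have hg0 : 0 < ‖g‖ := norm_pos_iff.2 fun h => hgv (by simp [h])
      -- With ‖g - h‖ < ‖g‖/4 and g(y_h) = 0, ‖h‖/2 ≤ |h(y_h)| < ‖g‖/4, although ‖h‖ > 3‖g‖/4.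
      obtain ⟨h, hh, hgh⟩ := Metric.mem_closure_iff.1
        (hZc (hZ g fun w hw => hgT w (Submodule.mem_sup_left hw))) (‖g‖ / 4) (by positivity)
      have hgy : g (y h) = 0 := hgT _ (Submodule.mem_sup_right
        (Submodule.subset_span (Set.mem_image_of_mem y hh)))
      rw [dist_eq_norm, norm_sub_rev] at hgh
      have h1 : ‖h (y h)‖ ≤ ‖h - g‖ := by
        have := (h - g).unit_le_opNorm (y h) (hy1 h)
        rwa [sub_apply, hgy, sub_zero] at this
      have h2 := norm_sub_norm_le g h
      rw [norm_sub_rev] at h2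
      linarith [hy2 h]
    have hd : Dense (Y.mkQ '' (T : Set X)) :=
      (Submodule.mkQ_surjective Y).denseRange.dense_image
        (continuous_quotient_mk' : Continuous Y.mkQ) hT
    have hsub : Y.mkQ '' (T : Set X) ⊆ Y.mkQ '' (Submodule.span 𝕜 (y '' c) : Set X) := by
      rintro _ ⟨w, hw, rfl⟩
      obtain ⟨a, ha, b, hb, rfl⟩ := Submodule.mem_sup.1 hw
      have ha' : Y.mkQ a = 0 := by simpa using ha
      exact ⟨b, hb, by rw [map_add, ha', zero_add]⟩
    have hsep : TopologicalSpace.IsSeparable (Y.mkQ '' (T : Set X)) :=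
      (((hc.image y).isSeparable.span (R := 𝕜)).image
        (continuous_quotient_mk' : Continuous Y.mkQ)).mono hsub
    rw [← TopologicalSpace.isSeparable_univ_iff, ← hd.closure_eq]
    exact hsep.closure
  · intro hfd
    have hle : ∀ f : s, Y ≤ LinearMap.ker ((f : StrongDual 𝕜 X) : X →ₗ[𝕜] 𝕜) := fun f x hx =>
      (hY x).1 hx f f.2
    -- The functionals of `s` descend to independent functionals on X/Y, too many for a
    -- finite-dimensional dual.
    have hli' : LinearIndependent 𝕜 fun f : s => Y.liftQ _ (hle f) := by
      refine LinearIndependent.of_comp Y.mkQ.dualMap ?_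
      have h := LinearIndependent.map' (v := fun f : s => (f : StrongDual 𝕜 X)) hli
        (ContinuousLinearMap.coeLM 𝕜 : StrongDual 𝕜 X →ₗ[𝕜] X →ₗ[𝕜] 𝕜)
        (LinearMap.ker_eq_bot.2 ContinuousLinearMap.coe_injective)
      exact h
    have := hli'.finite
    exact hsi (Set.toFinite s)

/-! ### Combination of the two cases -/

theorem mainTheorem11 {𝕜 : Type*} [RCLike 𝕜] {X : Type u} [NormedAddCommGroup X]
    [NormedSpace 𝕜 X] [CompleteSpace X] (hinf : ¬ FiniteDimensional 𝕜 X)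
    (hlow : Cardinal.aleph0 ≤ densityCharacter X)
    (hup : densityCharacter X < Cardinal.lift.{u} boundingCardinal) :
    HasSeparableQuotient 𝕜 X := by
  let _ : NormedSpace ℝ X := NormedSpace.restrictScalars ℝ 𝕜 X
  have : IsScalarTower ℝ 𝕜 X := inferInstance
  by_cases hJ : Function.Surjective (NormedSpace.inclusionInDoubleDual ℝ X)
  · exact hasSeparableQuotient_of_reflexive hinf (surjective_inclusionInDoubleDual_of_real hJ)
  · obtain ⟨u, c, hc, hu, h0⟩ := exists_weakStar_null_of_not_reflexive hJ
    -- The extension u(x) - i u(ix) to 𝕜 is isometric and keeps weak-star nullity.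
    refine hasSeparableQuotient_of_weakStar_null (𝕜 := 𝕜) hup
      (f := fun n => (u n).extendRCLike) hc (fun n => by simpa using hu n) fun x => ?_
    have hr : ∀ y, Filter.Tendsto (fun n => (u n y : 𝕜)) Filter.atTop (nhds 0) := fun y => by
      simpa [Function.comp_def] using
        ((RCLike.continuous_ofReal (K := 𝕜)).tendsto (0 : ℝ)).comp (h0 y)
    simp only [StrongDual.extendRCLike_apply]
    simpa using (hr x).sub ((hr ((RCLike.I : 𝕜) • x)).const_mul (RCLike.I : 𝕜))
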